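/- **Continuous Łoś–Tarski theorem (Corollary 2.4).** Work in (one-sorted) continuous logic: let $\mathcal L$ be an arbitrary continuous signature, whose function and predicate symbols come with prescribed moduli of uniform continuity $(0,1]\to(0,1]$. An $\mathcal L$-structure is a nonempty complete metric space of diameter at most $1$ with interpretations of the function symbols, and of the predicate symbols as $[0,1]$-valued functions, that respect these moduli. Formulas are built from the atomic formulas $d(t_1,t_2)$ and $P(t_1,\dots,t_n)$ by using all continuous functions $[0,1]^k\to[0,1]$ as connectives and the quantifiers $\sup_x$ and $\inf_x$. A *closed condition* is an expression "$\sigma=0$" with $\sigma$ an $\mathcal L$-sentence; it is *universal* if $\sigma$ is of the form $\sup_{\vec x}\varphi(\vec x)$ with $\vec x$ a finite tuple of variables and $\varphi$ quantifier-free. An $\mathcal L$-theory $T$ is a set of closed conditions, and $\mathcal M\models T$ means that $\sigma^{\mathcal M}=0$ for every condition "$\sigma=0$" in $T$. We say that $T$ has a *universal axiomatization* if there is a set of universal conditions with exactly the same models as $T$. A *substructure* of $\mathcal M$ is a nonempty closed subset of $\mathcal M$ that is closed under the interpretations of the function symbols, with the metric and all symbols restricted to it. For every $\mathcal L$-theory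 $T$, the following are equivalent: 1. $T$ has a universal axiomatization; 2. for every $\mathcal M\models T$ and every substructure $\mathcal N$ of $\mathcal M$, we have $\mathcal N\models T$. -/

import Mathlib

universe u v w

namespace ContinuousLogic

/-- A modulus of uniform continuity: a function from `(0,1]` to `(0,1]`. -/
abbrev Modulus : Type := Set.Ioc (0 : ℝ) 1 → Set.Ioc (0 : ℝ) 1

/-- A signature for continuous logic: function and predicate symbols of every finite arity
(constant symbols are the function symbols of arity `0`), each with a prescribed modulus of
uniform continuity. As usual, predicates take values in `[0,1]` and the metric, which is a
logical symbol, is bounded by `1`. -/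
structure Signature where
  /-- The function symbols of each arity. -/
  Functions : ℕ → Type u
  /-- The predicate symbols of each arity. -/
  Predicates : ℕ → Type v
  /-- The modulus attached to a function symbol. -/
  funModulus : ∀ {n : ℕ}, Functions n → Modulus
  /-- The modulus attached to a predicate symbol. -/
  predModulus : ∀ {n : ℕ}, Predicates n → Modulus

namespace Signature

/-- A (metric) structure for the signature `L` on the metric space `M`: the space is nonempty,
complete and of diameter at most `1`, and the interpretations of the symbols respect the
prescribed moduli. Here `Fin n → M` carries the maximum metric. -/
class Structure (L : Signature.{u, v}) (M : Type w) [MetricSpace M] where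
  nonempty : Nonempty M
  complete : CompleteSpace M
  dist_le_one : ∀ x y : M, dist x y ≤ 1
  /-- The interpretation of function symbols. -/
  funMap : ∀ {n : ℕ}, L.Functions n → (Fin n → M) → M
  /-- The interpretation of predicate symbols. -/
  predMap : ∀ {n : ℕ}, L.Predicates n → (Fin n → M) → unitInterval
  dist_funMap_le : ∀ {n : ℕ} (f : L.Functions n) (ε : Set.Ioc (0 : ℝ) 1) (x y : Fin n → M),
    dist x y < (L.funModulus f ε : ℝ) → dist (funMap f x) (funMap f y) ≤ (ε : ℝ)
  abs_predMap_le : ∀ {n : ℕ} (P : L.Predicates n) (ε : Set.Ioc (0 : ℝ) 1) (x y : Fin n → M),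
    dist x y < (L.predModulus P ε : ℝ) →
      |(predMap P x : ℝ) - (predMap P y : ℝ)| ≤ (ε : ℝ)

/-- Terms whose variables are among `x₀, …, xₙ₋₁`. -/
inductive Term (L : Signature.{u, v}) (n : ℕ) : Type u
  | var : Fin n → Term L n
  | func : ∀ {k : ℕ}, L.Functions k → (Fin k → Term L n) → Term L n

/-- Formulas whose free variables are among `x₀, …, xₙ₋₁`. The connectives are all continuous
functions `[0,1]ᵏ → [0,1]`; the quantifiers `sup` and `inf` bind the last variable `xₙ`. -/
inductive Formula (L : Signature.{u, v}) : ℕ → Type (max u v)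
  | dist : ∀ {n : ℕ}, Term L n → Term L n → Formula L n
  | pred : ∀ {n k : ℕ}, L.Predicates k → (Fin k → Term L n) → Formula L n
  | conn : ∀ {n k : ℕ}, C(Fin k → unitInterval, unitInterval) → (Fin k → Formula L n) → Formula L n
  | sup : ∀ {n : ℕ}, Formula L (n + 1) → Formula L n
  | inf : ∀ {n : ℕ}, Formula L (n + 1) → Formula L n

/-- Sentences: formulas without free variables. -/
abbrev Sentence (L : Signature.{u, v}) : Type (max u v) := Formula L 0

/-- A theory is a set of closed conditions; the closed condition `σ = 0` is represented by the
sentence `σ`. -/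
abbrev Theory (L : Signature.{u, v}) : Type (max u v) := Set (Sentence L)

section Semantics

variable {L : Signature.{u, v}} {M : Type w} [MetricSpace M] [L.Structure M]

/-- The value of a term at a tuple. -/
def Term.realize {n : ℕ} (a : Fin n → M) : Term L n → M
  | .var i => a i
  | .func f ts => Structure.funMap f (fun i => (ts i).realize a)

/-- The value in `[0,1]` of a formula at a tuple. -/
noncomputable def Formula.realize : {n : ℕ} → Formula L n → (Fin n → M) → unitInterval
  | _, .dist s t, a =>
      ⟨Dist.dist (s.realize a) (t.realize a), dist_nonneg,
        Structure.dist_le_one (L := L) _ _⟩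
  | _, .pred P ts, a => Structure.predMap P (fun i => (ts i).realize a)
  | _, .conn c φs, a => c (fun i => (φs i).realize a)
  | _, .sup φ, a =>
      ⟨⨆ x : M, (φ.realize (Fin.snoc a x) : ℝ),
        Real.iSup_nonneg fun x => (φ.realize (Fin.snoc a x)).2.1,
        Real.iSup_le (fun x => (φ.realize (Fin.snoc a x)).2.2) zero_le_one⟩
  | _, .inf φ, a =>
      ⟨⨅ x : M, (φ.realize (Fin.snoc a x) : ℝ),
        Real.iInf_nonneg fun x => (φ.realize (Fin.snoc a x)).2.1,
        (ciInf_le ⟨0, Set.forall_mem_range.2 fun x => (φ.realize (Fin.snoc a x)).2.1⟩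
          (Classical.choice (Structure.nonempty L))).trans
            (φ.realize (Fin.snoc a (Classical.choice (Structure.nonempty L)))).2.2⟩

variable (M) in
/-- The value of a sentence in a structure. -/
noncomputable def Sentence.value (σ : Sentence L) : unitInterval :=
  Formula.realize (M := M) σ Fin.elim0

variable (M) in
/-- `M` is a model of `T`: every closed condition `σ = 0` in `T` is true in `M`. -/
def Theory.Models (T : Theory L) : Prop :=
  ∀ σ ∈ T, Sentence.value M σ = 0

end Semantics

/-- A substructure of `M`: a nonempty closed (equivalently, complete) subset of `M` that is
closed under the interpretations of the function symbols. -/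
structure Substructure (L : Signature.{u, v}) (M : Type w) [MetricSpace M] [L.Structure M] where
  /-- The underlying set. -/
  carrier : Set M
  nonempty' : carrier.Nonempty
  isClosed' : IsClosed carrier
  funMap_mem' : ∀ {n : ℕ} (f : L.Functions n) (x : Fin n → M),
    (∀ i, x i ∈ carrier) → Structure.funMap f x ∈ carrier

/-- The structure induced on a substructure: the metric and all symbols are restricted. -/
instance Substructure.instStructure {L : Signature.{u, v}} {M : Type w} [MetricSpace M]
    [L.Structure M] (N : L.Substructure M) : L.Structure N.carrier where
  nonempty := N.nonempty'.to_subtype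
  complete :=
    haveI : CompleteSpace M := Structure.complete L
    N.isClosed'.completeSpace_coe
  dist_le_one x y := Structure.dist_le_one (L := L) (x : M) (y : M)
  funMap f x := ⟨Structure.funMap f (fun i => (x i : M)), N.funMap_mem' f _ fun i => (x i).2⟩
  predMap P x := Structure.predMap P (fun i => (x i : M))
  dist_funMap_le f ε x y h :=
    Structure.dist_funMap_le f ε (fun i => (x i : M)) (fun i => (y i : M)) h
  abs_predMap_le P ε x y h :=
    Structure.abs_predMap_le P ε (fun i => (x i : M)) (fun i => (y i : M)) h

/-- Quantifier-free formulas. -/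
def Formula.IsQF {L : Signature.{u, v}} : {n : ℕ} → Formula L n → Prop
  | _, .dist _ _ => True
  | _, .pred _ _ => True
  | _, .conn _ φs => ∀ i, (φs i).IsQF
  | _, .sup _ => False
  | _, .inf _ => False

/-- The sentence `sup_{x₀} ⋯ sup_{xₙ₋₁} φ`. -/
def Formula.sups {L : Signature.{u, v}} : {n : ℕ} → Formula L n → Sentence L
  | 0, φ => φ
  | _ + 1, φ => Formula.sups (Formula.sup φ)

/-- Universal sentences: those of the form `sup_x φ(x)`, with `x` a finite tuple of variables
and `φ` quantifier-free. -/
def Sentence.IsUniversal {L : Signature.{u, v}} (σ : Sentence L) : Prop :=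
  ∃ (n : ℕ) (φ : Formula L n), φ.IsQF ∧ σ = φ.sups

/-- `Γ` axiomatizes `T`: the two sets of closed conditions have the same models. The underlying
sets of models range over a universe at least as large as that of the signature. -/
def Theory.Axiomatizes {L : Signature.{u, v}} (Γ T : Theory L) : Prop :=
  ∀ (M : Type (max u v w)) [MetricSpace M] [L.Structure M],
    Theory.Models M Γ ↔ Theory.Models M T

/-- `T` is axiomatized by a set of universal conditions. -/
def Theory.HasUniversalAxiomatization {L : Signature.{u, v}} (T : Theory L) : Prop :=
  ∃ Γ : Theory L, (∀ σ ∈ Γ, Sentence.IsUniversal σ) ∧ Theory.Axiomatizes.{u, v, w} Γ T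

/-- Every substructure of every model of `T` is a model of `T`. -/
def Theory.PreservedUnderSubstructures {L : Signature.{u, v}} (T : Theory L) : Prop :=
  ∀ (M : Type (max u v w)) [MetricSpace M] [L.Structure M], Theory.Models M T →
    ∀ N : L.Substructure M, Theory.Models N.carrier T

end Signature

end ContinuousLogic

namespace ContinuousLogic

open Filter Topology

/-! A universal condition says that a quantifier-free formula vanishes at every tuple; such formulas
keep their values in substructures, so universal theories pass to substructures. Conversely, let `M`
satisfy every universal consequence of `T`. It is enough to embed `M` in a model of `T`: the image
is a substructure, hence a model by preservation, and it is isomorphic to `M`.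

The embedding comes from metric compactness. Suppose finitely many atomic values with parameters in
`M` could not be matched within `ε` in any model of `T`. Then the sup of `ε` minus the total
deviation, truncated to `[0,1]`, would be a universal consequence of `T`; yet it is positive in `M`,
where the deviation is zero (`Theory.exists_approx`). An ultraproduct of approximating models is a
model of `T` by Łoś's theorem (`Ultraproduct.tendsto_realize`), and there the atomic values agree
exactly with those in `M` (`Ultraproduct.isEmbedding_mk`). -/

/-- The limit of a family of points of `[0,1]` along an ultrafilter. -/
noncomputable def ultraLim {I : Type*} (U : Ultrafilter I) (f : I → unitInterval) : unitInterval :=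
  (U.map f).lim

theorem tendsto_ultraLim {I : Type*} (U : Ultrafilter I) (f : I → unitInterval) :
    Tendsto f U (𝓝 (ultraLim U f)) :=
  (U.map f).le_nhds_lim

theorem ultraLim_eq {I : Type*} {U : Ultrafilter I} {f : I → unitInterval} {a : unitInterval}
    (h : Tendsto f U (𝓝 a)) : ultraLim U f = a :=
  tendsto_nhds_unique (tendsto_ultraLim U f) h

/-! ### Suprema, infima and Cauchy sequences in families -/

/-- If every section `y` of the family `N` has a limit value `F (π y)` along the ultrafilter, then
suprema converge to the supremum of the limit values. -/
theorem tendsto_iSup_of_surjective {I Q α : Type*} {N : I → Type*} [∀ i, Nonempty (N i)]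
    [ConditionallyCompleteLinearOrder α] [TopologicalSpace α] [OrderTopology α]
    [DenselyOrdered α] (U : Ultrafilter I) {π : (∀ i, N i) → Q} (hπ : Function.Surjective π)
    {f : ∀ i, N i → α} {F : Q → α} (hf : ∀ i, BddAbove (Set.range (f i)))
    (hF : BddAbove (Set.range F))
    (h : ∀ y : ∀ i, N i, Tendsto (fun i => f i (y i)) U (𝓝 (F (π y)))) :
    Tendsto (fun i => ⨆ x, f i x) U (𝓝 (⨆ q, F q)) := by
  classical
  have : Nonempty Q := ⟨π fun i => Classical.arbitrary (N i)⟩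
  refine tendsto_order.2 ⟨fun a ha => ?_, fun a ha => ?_⟩
  · obtain ⟨q, hq⟩ := exists_lt_of_lt_ciSup ha
    obtain ⟨y, rfl⟩ := hπ q
    filter_upwards [(h y).eventually (lt_mem_nhds hq)] with i hi
    exact hi.trans_le (le_ciSup (hf i) (y i))
  · by_contra hne
    -- For an ultrafilter, failing to hold eventually means failing eventually.
    rw [← Ultrafilter.eventually_not] at hne
    obtain ⟨b, hb, hba⟩ := exists_between ha
    -- One section exceeds `b` at every bad index. The gap `b < a` survives the limit, which
    -- preserves only `≤`.
    have hex : ∀ i, ∃ x : N i, ¬ (⨆ x, f i x) < a → b < f i x := fun i => by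
      by_cases hi : (⨆ x, f i x) < a
      · exact ⟨Classical.arbitrary _, fun h => absurd hi h⟩
      · obtain ⟨x, hx⟩ := exists_lt_of_lt_ciSup (hba.trans_le (not_lt.1 hi))
        exact ⟨x, fun _ => hx⟩
    choose y hy using hex
    have hle : b ≤ F (π y) := ge_of_tendsto (h y) (hne.mono fun i hi => (hy i hi).le)
    exact absurd (hle.trans (le_ciSup hF (π y))) (not_le.2 hb)

theorem tendsto_iInf_of_surjective {I Q α : Type*} {N : I → Type*} [∀ i, Nonempty (N i)]
    [ConditionallyCompleteLinearOrder α] [TopologicalSpace α] [OrderTopology α]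
    [DenselyOrdered α] (U : Ultrafilter I) {π : (∀ i, N i) → Q} (hπ : Function.Surjective π)
    {f : ∀ i, N i → α} {F : Q → α} (hf : ∀ i, BddBelow (Set.range (f i)))
    (hF : BddBelow (Set.range F))
    (h : ∀ y : ∀ i, N i, Tendsto (fun i => f i (y i)) U (𝓝 (F (π y)))) :
    Tendsto (fun i => ⨅ x, f i x) U (𝓝 (⨅ q, F q)) :=
  tendsto_iSup_of_surjective (α := αᵒᵈ) U hπ hf hF h

/-- A point approximating every initial segment of a sequence which is Cauchy with rate `B`. -/
theorem exists_dist_le_of_controlled {X : Type*} [PseudoMetricSpace X] [CompleteSpace X]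
    {B : ℕ → ℝ} (hB : ∀ n, 0 ≤ B n) (hB₀ : Tendsto B atTop (𝓝 0)) (s : ℕ → X) :
    ∃ x, ∀ K, (∀ n m, n ≤ m → m ≤ K → dist (s n) (s m) ≤ B n) → dist (s K) x ≤ B K := by
  classical
  by_cases hs : ∀ K n m, n ≤ m → m ≤ K → dist (s n) (s m) ≤ B n
  · have hs' : ∀ n m, n ≤ m → dist (s n) (s m) ≤ B n := fun n m hnm => hs m n m hnm le_rfl
    obtain ⟨x, hx⟩ := cauchySeq_tendsto_of_complete <|
      cauchySeq_of_le_tendsto_0' B hs' hB₀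
    refine ⟨x, fun K _ => ?_⟩
    refine le_of_tendsto (tendsto_const_nhds.dist hx) ?_
    filter_upwards [eventually_ge_atTop K] with m hm using hs' K m hm
  · have hs' : ∃ K, ¬ ∀ n m, n ≤ m → m ≤ K → dist (s n) (s m) ≤ B n := not_forall.1 hs
    have hpos : Nat.find hs' ≠ 0 := fun h0 => by
      refine Nat.find_spec hs' fun n m hnm hm => ?_
      rw [h0] at hm
      obtain rfl : m = 0 := by omega
      obtain rfl : n = 0 := by omega
      simpa using hB 0
    have hmin := not_not.1 (Nat.find_min hs' (Nat.sub_one_lt hpos))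
    -- The last index before control fails: every controlled `K` is at most this one, so one point
    -- serves them all.
    refine ⟨s (Nat.find hs' - 1), fun K hK => hmin _ _ ?_ le_rfl⟩
    by_contra hlt
    exact Nat.find_spec hs' fun n m hnm hm => hK n m hnm (by omega)

theorem eq_of_forall_dist_le_Ioc {X : Type*} [MetricSpace X] {x y : X}
    (h : ∀ ε : Set.Ioc (0 : ℝ) 1, dist x y ≤ ε) : x = y := by
  refine eq_of_forall_dist_le fun ε hε => ?_
  exact (h ⟨min ε 1, lt_min hε one_pos, min_le_right _ _⟩).trans (min_le_left _ _)

theorem snoc_apply_family {I : Type*} {N : I → Type*} {n : ℕ} (x : Fin n → ∀ i, N i)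
    (y : ∀ i, N i) (i : I) :
    (Fin.snoc (fun j => x j i) (y i) : Fin (n + 1) → _) =
      fun j => (Fin.snoc x y : Fin (n + 1) → ∀ i, N i) j i :=
  (Fin.comp_snoc (fun z : ∀ i, N i => z i) x y).symm

namespace Signature

/-- The distance as an element of `[0,1]`. -/
def unitDist (L : Signature.{u, v}) {M : Type w} [MetricSpace M] [L.Structure M] (x y : M) :
    unitInterval :=
  ⟨dist x y, dist_nonneg, Structure.dist_le_one (L := L) x y⟩

theorem Structure.funMap_congr_dist {L : Signature.{u, v}} {M : Type w} [MetricSpace M]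
    [L.Structure M] {n : ℕ} (f : L.Functions n) (ε : Set.Ioc (0 : ℝ) 1) (x y : Fin n → M)
    (h : ∀ j, dist (x j) (y j) < L.funModulus f ε) :
    dist (Structure.funMap f x) (Structure.funMap f y) ≤ ε :=
  Structure.dist_funMap_le f ε x y ((dist_pi_lt_iff (L.funModulus f ε).2.1).2 h)

theorem Structure.predMap_congr_dist {L : Signature.{u, v}} {M : Type w} [MetricSpace M]
    [L.Structure M] {n : ℕ} (P : L.Predicates n) (ε : Set.Ioc (0 : ℝ) 1) (x y : Fin n → M)
    (h : ∀ j, dist (x j) (y j) < L.predModulus P ε) :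
    dist (Structure.predMap P x) (Structure.predMap P y) ≤ ε :=
  Structure.abs_predMap_le P ε x y ((dist_pi_lt_iff (L.predModulus P ε).2.1).2 h)

/-! ### Metric ultraproducts and Łoś's theorem -/

section Ultraproduct

variable (L : Signature.{u, v}) {I : Type*} (U : Ultrafilter I) (N : I → Type w)
  [∀ i, MetricSpace (N i)] [∀ i, L.Structure (N i)]

/-- The product of a family of structures, carrying the pseudometric given by the limit of
distances along an ultrafilter. -/
@[nolint unusedArguments]
def PreUltraproduct (_L : Signature.{u, v}) {I : Type*} (_U : Ultrafilter I) (N : I → Type w) :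
    Type _ :=
  ∀ i, N i

noncomputable instance PreUltraproduct.instPseudoMetricSpace :
    PseudoMetricSpace (PreUltraproduct L U N) where
  dist x y := ultraLim U fun i => unitDist L (x i) (y i)
  dist_self x := by
    have : ultraLim U (fun i => unitDist L (x i) (x i)) = 0 :=
      ultraLim_eq (tendsto_const_nhds.congr fun i => Subtype.ext (dist_self (x i)).symm)
    rw [this]; rfl
  dist_comm x y := by
    have : ∀ i, unitDist L (x i) (y i) = unitDist L (y i) (x i) :=
      fun i => Subtype.ext (dist_comm _ _)
    simp_rw [this]
  dist_triangle x y z := by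
    have h := fun x y : PreUltraproduct L U N => (continuous_subtype_val.tendsto _).comp
      (tendsto_ultraLim U fun i => unitDist L (x i) (y i))
    exact le_of_tendsto_of_tendsto' (h x z) ((h x y).add (h y z)) fun i => dist_triangle _ _ _

variable {L U N}

theorem PreUltraproduct.tendsto_dist (x y : PreUltraproduct L U N) :
    Tendsto (fun i => dist (x i) (y i)) U (𝓝 (dist x y)) :=
  (continuous_subtype_val.tendsto _).comp (tendsto_ultraLim U fun i => unitDist L (x i) (y i))

/-- For each `K`, the terms up to `K` obey the geometric rate in almost every factor. The
coordinates of the limit do not depend on `K`, so they are within `(1/2)^K` of the `K`-th term in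
almost every factor, for all `K` at once. -/
instance PreUltraproduct.instCompleteSpace : CompleteSpace (PreUltraproduct L U N) := by
  have hB : Tendsto (fun n : ℕ => ((1 : ℝ) / 2) ^ n) atTop (𝓝 0) :=
    tendsto_pow_atTop_nhds_zero_of_lt_one (by norm_num) (by norm_num)
  refine Metric.complete_of_convergent_controlled_sequences (fun n => (1 / 2) ^ n)
    (fun n => by positivity) fun s hs => ?_
  have hex : ∀ i, _ := fun i =>
    haveI : CompleteSpace (N i) := Structure.complete L
    exists_dist_le_of_controlled (X := N i) (B := fun n => (1 / 2) ^ n)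
      (fun n => by positivity) hB fun n => s n i
  choose x hx using hex
  refine ⟨x, tendsto_iff_dist_tendsto_zero.2 <|
    squeeze_zero (fun _ => dist_nonneg) (fun K => ?_) hB⟩
  refine le_of_tendsto (PreUltraproduct.tendsto_dist (s K) x) ?_
  have hev : ∀ᶠ i in (U : Filter I), ∀ n ∈ Finset.range (K + 1), ∀ m ∈ Finset.range (K + 1),
      n ≤ m → dist (s n i) (s m i) < (1 / 2) ^ n := by
    refine (eventually_all_finset _).2 fun n _ => (eventually_all_finset _).2 fun m _ => ?_
    by_cases hnm : n ≤ m
    · filter_upwards [(PreUltraproduct.tendsto_dist (s n) (s m)).eventually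
        (gt_mem_nhds (hs n n m le_rfl hnm))] with i hi _ using hi
    · exact .of_forall fun i h => absurd h hnm
  filter_upwards [hev] with i hi
  refine hx i K fun n m hnm hm => (hi n ?_ m ?_ hnm).le <;> simp <;> omega

variable (L U N) in
/-- The metric ultraproduct of a family of structures. -/
abbrev Ultraproduct : Type _ := SeparationQuotient (PreUltraproduct L U N)

namespace Ultraproduct

/-- The class of a family of points. -/
noncomputable def mk (x : ∀ i, N i) : Ultraproduct L U N :=
  (SeparationQuotient.mk : PreUltraproduct L U N → Ultraproduct L U N) x

theorem mk_surjective : Function.Surjective (mk : (∀ i, N i) → Ultraproduct L U N) :=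
  SeparationQuotient.surjective_mk (X := PreUltraproduct L U N)

/-- A representative of an element of the ultraproduct. -/
noncomputable def rep (x : Ultraproduct L U N) : ∀ i, N i :=
  Function.surjInv mk_surjective x

@[simp] theorem mk_rep (x : Ultraproduct L U N) : mk (rep x) = x :=
  Function.surjInv_eq _ x

theorem tendsto_dist (x y : ∀ i, N i) :
    Tendsto (fun i => dist (x i) (y i)) U
      (𝓝 (dist (mk x : Ultraproduct L U N) (mk y))) :=
  PreUltraproduct.tendsto_dist (L := L) (U := U) (N := N) x y

theorem eventually_dist_lt {n : ℕ} {x y : Fin n → ∀ i, N i} {δ : ℝ}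
    (h : ∀ j, dist (mk (x j) : Ultraproduct L U N) (mk (y j)) < δ) :
    ∀ᶠ i in (U : Filter I), ∀ j, dist (x j i) (y j i) < δ :=
  eventually_all.2 fun j => (tendsto_dist (x j) (y j)).eventually (gt_mem_nhds (h j))

/-- The strict hypothesis descends to almost every factor, and the non-strict bound passes back to
the limit. This gives both the modulus and, at distance zero, independence of representatives. -/
theorem dist_mk_funMap_le {n : ℕ} (f : L.Functions n) (ε : Set.Ioc (0 : ℝ) 1)
    (x y : Fin n → ∀ i, N i)
    (h : ∀ j, dist (mk (x j) : Ultraproduct L U N) (mk (y j)) < L.funModulus f ε) :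
    dist (mk (fun i => Structure.funMap f fun j => x j i) : Ultraproduct L U N)
      (mk fun i => Structure.funMap f fun j => y j i) ≤ ε :=
  le_of_tendsto (tendsto_dist _ _) <| (eventually_dist_lt h).mono fun _ hi =>
    Structure.funMap_congr_dist f ε _ _ hi

theorem dist_ultraLim_predMap_le {n : ℕ} (P : L.Predicates n) (ε : Set.Ioc (0 : ℝ) 1)
    (x y : Fin n → ∀ i, N i)
    (h : ∀ j, dist (mk (x j) : Ultraproduct L U N) (mk (y j)) < L.predModulus P ε) :
    dist (ultraLim U fun i => Structure.predMap P fun j => x j i)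
      (ultraLim U fun i => Structure.predMap P fun j => y j i) ≤ ε :=
  le_of_tendsto ((tendsto_ultraLim U _).dist (tendsto_ultraLim U _)) <|
    (eventually_dist_lt h).mono fun _ hi => Structure.predMap_congr_dist P ε _ _ hi

noncomputable instance instStructure : L.Structure (Ultraproduct L U N) where
  nonempty := ⟨mk fun _ => Classical.choice (Structure.nonempty L)⟩
  complete := inferInstance
  dist_le_one x y := by
    rw [← mk_rep x, ← mk_rep y]
    exact le_of_tendsto (tendsto_dist _ _) (.of_forall fun _ => Structure.dist_le_one (L := L) _ _)
  funMap f x := mk fun i => Structure.funMap f fun j => rep (x j) i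
  predMap P x := ultraLim U fun i => Structure.predMap P fun j => rep (x j) i
  dist_funMap_le f ε x y h := dist_mk_funMap_le f ε _ _ fun j => by
    simpa using (dist_le_pi_dist x y j).trans_lt h
  abs_predMap_le P ε x y h := dist_ultraLim_predMap_le P ε _ _ fun j => by
    simpa using (dist_le_pi_dist x y j).trans_lt h

theorem funMap_mk {n : ℕ} (f : L.Functions n) (x : Fin n → ∀ i, N i) :
    Structure.funMap f (fun j => (mk (x j) : Ultraproduct L U N)) =
      mk fun i => Structure.funMap f fun j => x j i :=
  eq_of_forall_dist_le_Ioc fun ε => dist_mk_funMap_le f ε _ _ fun j => by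
    simpa using (L.funModulus f ε).2.1

theorem tendsto_predMap {n : ℕ} (P : L.Predicates n) (x : Fin n → ∀ i, N i) :
    Tendsto (fun i => Structure.predMap P fun j => x j i) U
      (𝓝 (Structure.predMap P fun j => (mk (x j) : Ultraproduct L U N))) := by
  have : Structure.predMap P (fun j => (mk (x j) : Ultraproduct L U N)) =
      ultraLim U fun i => Structure.predMap P fun j => x j i :=
    eq_of_forall_dist_le_Ioc fun ε => dist_ultraLim_predMap_le P ε _ _ fun j => by
      simpa using (L.predModulus P ε).2.1
  rw [this]
  exact tendsto_ultraLim U _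

theorem term_realize_mk {n : ℕ} (t : L.Term n) (x : Fin n → ∀ i, N i) :
    t.realize (fun j => (mk (x j) : Ultraproduct L U N)) =
      mk fun i => t.realize fun j => x j i := by
  induction t with
  | var j => rfl
  | func f ts ih =>
    simp only [Term.realize, ih]
    exact funMap_mk f _

theorem snoc_mk {n : ℕ} (x : Fin n → ∀ i, N i) (y : ∀ i, N i) :
    (Fin.snoc (fun j => (mk (x j) : Ultraproduct L U N)) (mk y) : Fin (n + 1) → _) =
      fun j => mk ((Fin.snoc x y : Fin (n + 1) → ∀ i, N i) j) :=
  (Fin.comp_snoc (mk : _ → Ultraproduct L U N) x y).symm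

/-- **Łoś's theorem**: the value of a formula in an ultraproduct is the limit of its values. -/
theorem tendsto_realize {n : ℕ} (φ : L.Formula n) (x : Fin n → ∀ i, N i) :
    Tendsto (fun i => φ.realize fun j => x j i) U
      (𝓝 (φ.realize fun j => (mk (x j) : Ultraproduct L U N))) := by
  have : ∀ i, Nonempty (N i) := fun i => Structure.nonempty L
  induction φ with
  | dist s t =>
    refine tendsto_subtype_rng.2 ?_
    simp only [Formula.realize, term_realize_mk]
    exact tendsto_dist _ _
  | pred P ts =>
    simp only [Formula.realize, term_realize_mk]
    exact tendsto_predMap P _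
  | conn c φs ih =>
    simp only [Formula.realize]
    exact (c.continuous.tendsto _).comp (tendsto_pi_nhds.2 fun k => ih k x)
  | sup φ ih =>
    refine tendsto_subtype_rng.2 ?_
    simp only [Formula.realize]
    -- Every point of the ultraproduct is the class of a section, so the induction hypothesis
    -- applies to all witnesses.
    refine tendsto_iSup_of_surjective U (mk_surjective (L := L) (U := U) (N := N))
      (fun i => ⟨1, Set.forall_mem_range.2 fun z => (φ.realize (Fin.snoc _ z)).2.2⟩)
      ⟨1, Set.forall_mem_range.2 fun z => (φ.realize (Fin.snoc _ z)).2.2⟩ fun y => ?_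
    simp only [snoc_mk, snoc_apply_family]
    exact (continuous_subtype_val.tendsto _).comp (ih _)
  | inf φ ih =>
    refine tendsto_subtype_rng.2 ?_
    simp only [Formula.realize]
    refine tendsto_iInf_of_surjective U (mk_surjective (L := L) (U := U) (N := N))
      (fun i => ⟨0, Set.forall_mem_range.2 fun z => (φ.realize (Fin.snoc _ z)).2.1⟩)
      ⟨0, Set.forall_mem_range.2 fun z => (φ.realize (Fin.snoc _ z)).2.1⟩ fun y => ?_
    simp only [snoc_mk, snoc_apply_family]
    exact (continuous_subtype_val.tendsto _).comp (ih _)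

theorem models {T : L.Theory} (h : ∀ i, Theory.Models (N i) T) :
    Theory.Models (Ultraproduct L U N) T := fun σ hσ => by
  have hlim := tendsto_realize (U := U) (N := N) σ Fin.elim0
  have h0 : ∀ i, σ.realize (fun j => (Fin.elim0 j : ∀ i, N i) i) = 0 := fun i => by
    rw [← h i σ hσ, Sentence.value]
    congr 1
    exact Subsingleton.elim _ _
  simp only [h0] at hlim
  rw [Sentence.value, ← tendsto_nhds_unique hlim tendsto_const_nhds]
  congr 1
  exact Subsingleton.elim _ _

end Ultraproduct

end Ultraproduct

/-! ### Embeddings and preservation of values -/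

section Embedding

variable {L : Signature.{u, v}} {M N : Type*} [MetricSpace M] [L.Structure M]
  [MetricSpace N] [L.Structure N]

/-- Isometric embeddings of structures. -/
structure IsEmbedding (L : Signature.{u, v}) {M N : Type*} [MetricSpace M] [L.Structure M]
    [MetricSpace N] [L.Structure N] (g : M → N) : Prop where
  isometry : Isometry g
  map_funMap : ∀ {n : ℕ} (f : L.Functions n) (x : Fin n → M),
    g (Structure.funMap f x) = Structure.funMap f fun j => g (x j)
  predMap_map : ∀ {n : ℕ} (P : L.Predicates n) (x : Fin n → M),
    (Structure.predMap P fun j => g (x j)) = Structure.predMap P x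

theorem Substructure.isEmbedding_val (S : L.Substructure M) :
    IsEmbedding L (Subtype.val : S.carrier → M) where
  isometry := isometry_subtype_coe
  map_funMap _ _ := rfl
  predMap_map _ _ := rfl

namespace IsEmbedding

variable {g : M → N} (hg : IsEmbedding L g)
include hg

theorem term_realize {n : ℕ} (t : L.Term n) (a : Fin n → M) :
    t.realize (fun j => g (a j)) = g (t.realize a) := by
  induction t with
  | var j => rfl
  | func f ts ih => simp only [Term.realize, ih, hg.map_funMap]

theorem realize_of_isQF {n : ℕ} (φ : L.Formula n) (hφ : φ.IsQF) (a : Fin n → M) :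
    φ.realize (fun j => g (a j)) = φ.realize a := by
  induction φ with
  | dist s t => simp only [Formula.realize, hg.term_realize, hg.isometry.dist_eq]
  | pred P ts => simp only [Formula.realize, hg.term_realize, hg.predMap_map]
  | conn c φs ih => simp only [Formula.realize, ih _ (hφ _)]
  | sup φ => exact hφ.elim
  | inf φ => exact hφ.elim

/-- Surjectivity lets the sup and inf over `N` be reindexed along `g`, so quantifiers cause no loss.
-/
theorem realize_of_surjective (hs : Function.Surjective g) {n : ℕ} (φ : L.Formula n)
    (a : Fin n → M) : φ.realize (fun j => g (a j)) = φ.realize a := by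
  induction φ with
  | dist s t => simp only [Formula.realize, hg.term_realize, hg.isometry.dist_eq]
  | pred P ts => simp only [Formula.realize, hg.term_realize, hg.predMap_map]
  | conn c φs ih => simp only [Formula.realize, ih]
  | sup φ ih =>
    simp only [Formula.realize, ← hs.iSup_comp, ← ih]
    congr! 5 with x
    exact (Fin.comp_snoc g a x).symm
  | inf φ ih =>
    simp only [Formula.realize, ← hs.iInf_comp, ← ih]
    congr! 5 with x
    exact (Fin.comp_snoc g a x).symm

theorem models_of_surjective (hs : Function.Surjective g) {T : L.Theory}
    (h : Theory.Models N T) : Theory.Models M T := fun σ hσ => by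
  rw [← h σ hσ, Sentence.value, Sentence.value, ← hg.realize_of_surjective hs]
  congr 1
  exact Subsingleton.elim _ _

/-- The range of an embedding, as a substructure. -/
def range : L.Substructure N where
  carrier := Set.range g
  nonempty' :=
    have : Nonempty M := Structure.nonempty L
    Set.range_nonempty g
  isClosed' :=
    have : CompleteSpace M := Structure.complete L
    hg.isometry.isClosedEmbedding.isClosed_range
  funMap_mem' f x hx := by
    choose y hy using hx
    exact ⟨Structure.funMap f y, by simp only [hg.map_funMap, hy]⟩

/-- An embedding, as a map onto its range. -/
def toRange (x : M) : hg.range.carrier :=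
  ⟨g x, x, rfl⟩

theorem toRange_surjective : Function.Surjective hg.toRange := by
  rintro ⟨_, x, rfl⟩
  exact ⟨x, rfl⟩

theorem isEmbedding_toRange : IsEmbedding L hg.toRange where
  isometry := Isometry.of_dist_eq hg.isometry.dist_eq
  map_funMap f x := Subtype.ext (hg.map_funMap f x)
  predMap_map P x := hg.predMap_map P x

end IsEmbedding

theorem Formula.realize_sup_eq_zero {n : ℕ} (φ : L.Formula (n + 1)) (a : Fin n → M) :
    φ.sup.realize a = 0 ↔ ∀ x, φ.realize (Fin.snoc a x) = 0 := by
  have hbdd : BddAbove (Set.range fun x => (φ.realize (Fin.snoc a x) : ℝ)) :=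
    ⟨1, Set.forall_mem_range.2 fun x => (φ.realize (Fin.snoc a x)).2.2⟩
  simp only [Subtype.ext_iff, Formula.realize]
  refine ⟨fun h x => le_antisymm ((le_ciSup hbdd x).trans h.le) (φ.realize _).2.1, fun h => ?_⟩
  simp [h]

theorem Formula.value_sups_eq_zero {n : ℕ} (φ : L.Formula n) :
    Sentence.value M φ.sups = 0 ↔ ∀ a : Fin n → M, φ.realize a = 0 := by
  induction n with
  | zero => exact ⟨fun h a => Subsingleton.elim Fin.elim0 a ▸ h, fun h => h _⟩
  | succ n ih =>
    simp only [Formula.sups, ih, Formula.realize_sup_eq_zero]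
    exact ⟨fun h a => Fin.snoc_init_self a ▸ h _ _, fun h a x => h _⟩

theorem IsEmbedding.models_of_isUniversal {g : M → N} (hg : IsEmbedding L g) {T : L.Theory}
    (hT : ∀ σ ∈ T, Sentence.IsUniversal σ) (h : Theory.Models N T) : Theory.Models M T :=
  fun σ hσ => by
    obtain ⟨n, φ, hφ, rfl⟩ := hT σ hσ
    rw [Formula.value_sups_eq_zero]
    intro a
    rw [← hg.realize_of_isQF φ hφ]
    exact (Formula.value_sups_eq_zero φ).1 (h _ hσ) _

end Embedding

/-! ### Approximate diagrams and compactness -/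

section Diagram

/-- The atomic expressions with parameters in `M` which determine the structure on `M`. -/
inductive Atom (L : Signature.{u, v}) (M : Type w) : Type (max u v w)
  | dist : M → M → Atom L M
  | func : ∀ {k : ℕ}, L.Functions k → (Fin k → M) → M → Atom L M
  | pred : ∀ {k : ℕ}, L.Predicates k → (Fin k → M) → Atom L M

namespace Atom

variable {L : Signature.{u, v}} {M : Type*} {N : Type*}

/-- The value of an atom under an assignment of its parameters. -/
def value [MetricSpace N] [L.Structure N] (g : M → N) : L.Atom M → unitInterval
  | .dist x y => unitDist L (g x) (g y)
  | .func f x y => unitDist L (Structure.funMap f fun j => g (x j)) (g y)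
  | .pred P x => Structure.predMap P fun j => g (x j)

/-- The atomic formula obtained by replacing parameters by variables. -/
def toFormula {m : ℕ} (ι : M → Fin m) : L.Atom M → L.Formula m
  | .dist x y => .dist (.var (ι x)) (.var (ι y))
  | .func f x y => .dist (.func f fun j => .var (ι (x j))) (.var (ι y))
  | .pred P x => .pred P fun j => .var (ι (x j))

/-- The parameters of an atom. -/
def support : L.Atom M → Set M
  | .dist x y => {x, y}
  | .func _ x y => insert y (Set.range x)
  | .pred _ x => Set.range x

theorem finite_support (c : L.Atom M) : c.support.Finite := by
  cases c with
  | dist x y => exact Set.toFinite {x, y}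
  | func f x y => exact (Set.finite_range x).insert y
  | pred P x => exact Set.finite_range x

theorem isQF_toFormula {m : ℕ} (ι : M → Fin m) (c : L.Atom M) : (c.toFormula ι).IsQF := by
  cases c <;> trivial

variable [MetricSpace N] [L.Structure N]

theorem realize_toFormula {m : ℕ} (ι : M → Fin m) (b : Fin m → N) (c : L.Atom M) :
    (c.toFormula ι).realize b = c.value fun x => b (ι x) := by
  cases c <;> rfl

theorem value_congr {g h : M → N} (c : L.Atom M) (hgh : ∀ x ∈ c.support, g x = h x) :
    c.value g = c.value h := by
  cases c with
  | dist x y => simp [value, hgh x (by simp [support]), hgh y (by simp [support])]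
  | func f x y =>
    have : ∀ j, g (x j) = h (x j) := fun j => hgh _ (by simp [support])
    simp [value, this, hgh y (by simp [support])]
  | pred P x =>
    have : ∀ j, g (x j) = h (x j) := fun j => hgh _ (by simp [support])
    simp [value, this]

end Atom

/-- A finite subset of a nonempty set can be listed by a tuple, with a left inverse. -/
theorem _root_.Set.Finite.exists_tuple {M : Type*} [Nonempty M] {s : Set M} (hs : s.Finite) :
    ∃ (m : ℕ) (e : Fin m → M) (ι : M → Fin m), ∀ x ∈ s, e (ι x) = x := by
  classical
  -- Adding a point makes the list nonempty, giving `ι` a default value off `s`.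
  let x₀ := Classical.arbitrary M
  have : Finite (insert x₀ s : Set M) := (hs.insert x₀).to_subtype
  obtain ⟨m, ⟨e⟩⟩ := Finite.exists_equiv_fin (insert x₀ s : Set M)
  refine ⟨m, fun i => e.symm i,
    fun x => if h : x ∈ (insert x₀ s : Set M) then e ⟨x, h⟩ else e ⟨x₀, by simp⟩, fun x hx => ?_⟩
  simp [hx]

/-- The connective `t ↦ ε ∸ ∑ i, |t i - r i|`. -/
noncomputable def deviationConn {k : ℕ} (ε : ℝ) (r : Fin k → unitInterval) :
    C(Fin k → unitInterval, unitInterval) where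
  toFun t := Set.projIcc 0 1 zero_le_one (ε - ∑ i, |(t i : ℝ) - r i|)
  continuous_toFun := continuous_projIcc.comp (by fun_prop)

theorem deviationConn_eq_zero {k : ℕ} (ε : ℝ) (r t : Fin k → unitInterval) :
    deviationConn ε r t = 0 ↔ ε ≤ ∑ i, |(t i : ℝ) - r i| := by
  -- Truncation at `1` does not affect the zero set, so `ε` may exceed `1`.
  exact (Set.projIcc_eq_left (zero_lt_one (α := ℝ))).trans sub_nonpos

variable {L : Signature.{u, v}}

/-- The universal consequences of a theory. -/
def Theory.universalPart (T : L.Theory) : L.Theory :=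
  {σ | Sentence.IsUniversal σ ∧
    ∀ (N : Type (max u v w)) [MetricSpace N] [L.Structure N],
      Theory.Models N T → Sentence.value N σ = 0}

/-- Finitely many atoms of a model of the universal part of `T` can be approximated in a model
of `T`. -/
theorem Theory.exists_approx {T : L.Theory} {M : Type*} [MetricSpace M] [L.Structure M]
    (hM : Theory.Models M (Theory.universalPart.{u, v, w} T)) (F : Finset (L.Atom M)) {ε : ℝ}
    (hε : 0 < ε) :
    ∃ (N : Type (max u v w)) (_ : MetricSpace N) (_ : L.Structure N) (g : M → N),
      Theory.Models N T ∧ ∀ c ∈ F, |(c.value g : ℝ) - c.value (id : M → M)| < ε := by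
  have : Nonempty M := Structure.nonempty L
  obtain ⟨m, e, ι, hι⟩ := Set.Finite.exists_tuple
    (F.finite_toSet.biUnion fun c _ => c.finite_support)
  let c : Fin F.card → L.Atom M := fun i => F.equivFin.symm i
  let φ : L.Formula m := .conn (deviationConn ε fun i => (c i).value (id : M → M))
    fun i => (c i).toFormula ι
  have hφ : ∀ {N : Type _} [MetricSpace N] [L.Structure N] (b : Fin m → N), φ.realize b = 0 ↔
      ε ≤ ∑ i, |((c i).value (fun x => b (ι x)) : ℝ) - (c i).value (id : M → M)| := fun b => by
    simp only [φ, Formula.realize, deviationConn_eq_zero, Atom.realize_toFormula]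
  -- At the actual parameters every deviation is zero, leaving the positive truncation of `ε`.
  have hφM : φ.realize e ≠ 0 := fun h => by
    simp only [φ, Formula.realize, deviationConn_eq_zero, Atom.realize_toFormula] at h
    refine absurd h (not_le.2 ?_)
    rw [Finset.sum_eq_zero fun i _ => ?_]
    · exact hε
    · rw [(c i).value_congr (h := id) fun x hx => hι x ?_, sub_self, abs_zero]
      exact Set.mem_biUnion (Finset.mem_coe.2 (F.equivFin.symm i).2) hx
  have hnot : φ.sups ∉ Theory.universalPart.{u, v, w} T := fun h =>
    hφM ((Formula.value_sups_eq_zero φ).1 (hM _ h) e)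
  have huniv : Sentence.IsUniversal φ.sups :=
    ⟨m, φ, fun i => (c i).isQF_toFormula ι, rfl⟩
  -- As `φ.sups` is universal but not a consequence of `T`, some model of `T` has a tuple with total
  -- deviation below `ε`.
  simp only [Theory.universalPart, Set.mem_ofPred_eq, huniv, true_and, not_forall] at hnot
  obtain ⟨N, i₁, i₂, hN, hne⟩ := hnot
  rw [Formula.value_sups_eq_zero, not_forall] at hne
  obtain ⟨b, hb⟩ := hne
  rw [hφ, not_le] at hb
  refine ⟨N, i₁, i₂, fun x => b (ι x), hN, fun d hd => lt_of_le_of_lt ?_ hb⟩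
  have := Finset.single_le_sum (f := fun i =>
    |((c i).value (fun x => b (ι x)) : ℝ) - (c i).value (id : M → M)|)
    (fun i _ => abs_nonneg _) (Finset.mem_univ (F.equivFin ⟨d, hd⟩))
  simpa [c] using this

/-- A family of maps preserving each atom in the limit induces an embedding into the
ultraproduct. -/
theorem Ultraproduct.isEmbedding_mk {M : Type*} [MetricSpace M] [L.Structure M] {I : Type*}
    {U : Ultrafilter I} {N : I → Type*} [∀ i, MetricSpace (N i)] [∀ i, L.Structure (N i)]
    {g : ∀ i, M → N i}
    (hg : ∀ c : L.Atom M,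
      Tendsto (fun i => (c.value (g i) : ℝ)) U (𝓝 (c.value (id : M → M)))) :
    IsEmbedding L fun x => (Ultraproduct.mk fun i => g i x : Ultraproduct L U N) where
  isometry := Isometry.of_dist_eq fun x y =>
    tendsto_nhds_unique (Ultraproduct.tendsto_dist _ _) (hg (.dist x y))
  map_funMap f x := by
    rw [Ultraproduct.funMap_mk f fun j i => g i (x j)]
    -- The atom comparing `f x` with its own value is `0` in `M`, so the limit distance is `0`.
    refine (dist_eq_zero.1 (tendsto_nhds_unique (Ultraproduct.tendsto_dist _ _) ?_)).symm
    simpa [Atom.value, unitDist] using hg (.func f x (Structure.funMap f x))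
  predMap_map P x :=
    tendsto_nhds_unique (Ultraproduct.tendsto_predMap P fun j i => g i (x j))
      (tendsto_subtype_rng.2 (hg (.pred P x)))

/-- A model of the universal part of `T` embeds in a model of `T`. -/
theorem Theory.exists_isEmbedding {T : L.Theory} {M : Type (max u v w)} [MetricSpace M]
    [L.Structure M] (hM : Theory.Models M (Theory.universalPart.{u, v, w} T)) :
    ∃ (N : Type (max u v w)) (_ : MetricSpace N) (_ : L.Structure N) (g : M → N),
      Theory.Models N T ∧ IsEmbedding L g := by
  classical
  -- Index `(F, n)` asks for the atoms in `F` up to `1 / (n + 1)`. The index type lies in universe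
  -- `max u v w`, so the ultraproduct does too.
  have happrox := fun i : Finset (L.Atom M) × ℕ =>
    Theory.exists_approx hM i.1 (Nat.one_div_pos_of_nat (α := ℝ) (n := i.2))
  choose N i₁ i₂ g hN hg using happrox
  -- Refining `atTop` makes each atom eventually belong to `F` while the tolerance tends to `0`.
  let U : Ultrafilter (Finset (L.Atom M) × ℕ) := Ultrafilter.of atTop
  have hU : (U : Filter (Finset (L.Atom M) × ℕ)) ≤ atTop := Ultrafilter.of_le atTop
  refine ⟨Ultraproduct L U N, inferInstance, inferInstance, _, Ultraproduct.models hN,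
    Ultraproduct.isEmbedding_mk (g := g) fun c => tendsto_iff_dist_tendsto_zero.2 ?_⟩
  have hsnd : Tendsto (Prod.snd : Finset (L.Atom M) × ℕ → ℕ) U atTop := by
    refine Tendsto.mono_left ?_ hU
    rw [← prod_atTop_atTop_eq]
    exact tendsto_snd
  refine squeeze_zero' (.of_forall fun _ => dist_nonneg) ?_
    (tendsto_one_div_add_atTop_nhds_zero_nat.comp hsnd)
  filter_upwards [hU (eventually_ge_atTop (({c}, 0) : Finset (L.Atom M) × ℕ))] with i hi
  exact (hg i c (hi.1 (Finset.mem_singleton_self c))).le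

theorem Theory.hasUniversalAxiomatization_of_preserved {T : L.Theory}
    (hT : Theory.PreservedUnderSubstructures.{u, v, w} T) :
    Theory.HasUniversalAxiomatization.{u, v, w} T := by
  refine ⟨Theory.universalPart.{u, v, w} T, fun σ hσ => hσ.1, fun M _ _ => ⟨fun hM => ?_,
    fun hM σ hσ => hσ.2 M hM⟩⟩
  obtain ⟨N, _, _, g, hN, hg⟩ := Theory.exists_isEmbedding hM
  exact hg.isEmbedding_toRange.models_of_surjective hg.toRange_surjective
    (hT N hN hg.range)

theorem Theory.preserved_of_hasUniversalAxiomatization {T : L.Theory}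
    (hT : Theory.HasUniversalAxiomatization.{u, v, w} T) :
    Theory.PreservedUnderSubstructures.{u, v, w} T := by
  obtain ⟨Γ, hΓ, hax⟩ := hT
  intro M _ _ hM S
  exact (hax S.carrier).1 (S.isEmbedding_val.models_of_isUniversal hΓ ((hax M).2 hM))

end Diagram

end Signature

end ContinuousLogic

theorem corollary2p4 (L : ContinuousLogic.Signature.{u, v}) (T : L.Theory) :
    ContinuousLogic.Signature.Theory.HasUniversalAxiomatization.{u, v, w} T ↔
      ContinuousLogic.Signature.Theory.PreservedUnderSubstructures.{u, v, w} T :=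
  ⟨ContinuousLogic.Signature.Theory.preserved_of_hasUniversalAxiomatization,
    ContinuousLogic.Signature.Theory.hasUniversalAxiomatization_of_preserved⟩
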